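/- Let $\mathbb F$ be a field and let $\mathcal M=(\mathcal M(n))_{n\ge 0}$ be a $\Sigma$-module, i.e. each $\mathcal M(n)$ is an $\mathbb F$-linear representation of the symmetric group $\Sigma_n$. Suppose that each $\mathcal M(n)$ is endowed with a basis $\mathcal B(n)$ which is stable under the action of $\Sigma_n$. *Notation.* $\operatorname{Comp}_p(n)$ is the set of $p$-tuples $r=(r_1,\dots,r_p)$ of non-negative integers with $r_1+\dots+r_p=n$; such an $r$ cuts $\{1,\dots,n\}$ into consecutive blocks of sizes $r_1,\dots,r_p$, and $\Sigma_r\cong\Sigma_{r_1}\times\dots\times\Sigma_{r_p}\subseteq\Sigma_n$ is the subgroup preserving each block. For $\rho\in\Sigma_p$, $r^\rho=(r_{\rho^{-1}(1)},\dots,r_{\rho^{-1}(p)})$ and $\rho^*\in\Sigma_n$ is the block permutation sending the $i$-th block of $r$ to the $\rho(i)$-th block of $r^\rho$ in an order-preserving way. For $q\in\operatorname{Comp}_s(p)$, $q\rhd r\in\operatorname{Comp}_s(n)$ has as $j$-th entry the sum of the $r_i$ with $i$ in the $j$-th block of $q$. For $l+m=r_1$, $r\circ_1(l,m)=(l,m,r_2,\dots,r_p)$.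 For $x\in\mathcal B(n)$, $[x]_r$, $\Omega_r(x)$ and $\operatorname{Stab}_r(x)$ are the class, the orbit and the stabiliser of $x$ under $\Sigma_r$. *The category $\beta(\mathcal M)$.* Objects are $\mathbb F$-vector spaces $A$ with maps $\beta_{x,r}:A^{\times p}\to A$ for all $n$, $p$, $r\in\operatorname{Comp}_p(n)$ and $x\in\mathcal M(n)^{\Sigma_r}$, such that - ($\beta$1) $\beta_{x,r}(a_1,\dots,a_p)=\beta_{\rho^*\cdot x,r^\rho}(a_{\rho^{-1}(1)},\dots,a_{\rho^{-1}(p)})$ for $\rho\in\Sigma_p$; - ($\beta$2) $\beta_{x,(0,r_1,\dots,r_p)}(a_0,a_1,\dots,a_p)=\beta_{x,r}(a_1,\dots,a_p)$; - ($\beta$3) $\beta_{x,r}(\lambda a_1,a_2,\dots,a_p)=\lambda^{r_1}\beta_{x,r}(a_1,\dots,a_p)$ for $\lambda\in\mathbb F$; - ($\beta$4) $\beta_{x,r}(\underbrace{a_1,\dots,a_1}_{q_1},\dots,\underbrace{a_s,\dots,a_s}_{q_s})=\beta_{\sum_{\sigma\in\Sigma_{q\rhd r}/\Sigma_r}\sigma\cdot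 x,\;q\rhd r}(a_1,\dots,a_s)$ for $q\in\operatorname{Comp}_s(p)$; - ($\beta$5) $\beta_{x,r}(a_0+a_1,a_2,\dots,a_p)=\sum_{l+m=r_1}\beta_{x,r\circ_1(l,m)}(a_0,a_1,\dots,a_p)$; - ($\beta$6) $\beta_{\lambda x+y,r}=\lambda\beta_{x,r}+\beta_{y,r}$ for $\lambda\in\mathbb F$ and $x,y\in\mathcal M(n)^{\Sigma_r}$. Morphisms are the linear maps compatible with all operations. *The category $\gamma(\mathcal M)$.* Objects are $\mathbb F$-vector spaces $A$ with maps $\gamma_{[x]_r,r}:A^{\times p}\to A$ for all $n$, $p$, $r\in\operatorname{Comp}_p(n)$ and $[x]_r\in\Sigma_r\backslash\mathcal B(n)$, such that - ($\gamma$1) $\gamma_{[x]_r,r}(a_1,\dots,a_p)=\gamma_{[\rho^*\cdot x]_{r^\rho},r^\rho}(a_{\rho^{-1}(1)},\dots,a_{\rho^{-1}(p)})$ for $\rho\in\Sigma_p$; - ($\gamma$2) $\gamma_{[x],(0,r_1,\dots,r_p)}(a_0,a_1,\dots,a_p)=\gamma_{[x]_r,r}(a_1,\dots,a_p)$; - ($\gamma$3)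 $\gamma_{[x]_r,r}(\lambda a_1,a_2,\dots,a_p)=\lambda^{r_1}\gamma_{[x]_r,r}(a_1,\dots,a_p)$ for $\lambda\in\mathbb F$; - ($\gamma$4) $\gamma_{[x]_r,r}(\underbrace{a_1,\dots,a_1}_{q_1},\dots,\underbrace{a_s,\dots,a_s}_{q_s})=\frac{|\operatorname{Stab}_{q\rhd r}(x)|}{|\operatorname{Stab}_r(x)|}\,\gamma_{[x]_{q\rhd r},q\rhd r}(a_1,\dots,a_s)$ for $q\in\operatorname{Comp}_s(p)$, the quotient being an integer, which is mapped to $\mathbb F$; - ($\gamma$5) $\gamma_{[x]_r,r}(a_0+a_1,a_2,\dots,a_p)=\sum_{l+m=r_1}\ \sum_{[y]\in\Sigma_{r\circ_1(l,m)}\backslash\Omega_r(x)}\gamma_{[y],r\circ_1(l,m)}(a_0,a_1,\dots,a_p)$. Morphisms are the linear maps compatible with all operations. *The functor $P_{\mathcal M}$.* It sends $(A,\beta)$ to $(A,\gamma)$ with $\gamma_{[x]_r,r}=\beta_{\mathcal O_r([x]_r),r}$, where $\mathcal O_r([x]_r)=\sum_{y\in\Omega_r(x)}y\in\mathcal M(n)^{\Sigma_r}$,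 and it sends each morphism to the same underlying linear map. Then the functor $P_{\mathcal M}:\beta(\mathcal M)\to\gamma(\mathcal M)$ is an isomorphism of categories. -/

import Mathlib

universe u v w

namespace GenDivPow

open CategoryTheory Equiv

/-- A composition of `n` into `p` parts: a `p`-tuple of non-negative integers with sum `n`. -/
structure Comp (p n : ℕ) where
  parts : Fin p → ℕ
  sum_eq : ∑ i, parts i = n

namespace Comp

variable {p n s : ℕ}

/-- The identification of the disjoint union of the blocks of sizes `r₁, …, r_p` with `[n]`,
the blocks being consecutive intervals. -/
def blockEquiv (r : Comp p n) : (Σ i : Fin p, Fin (r.parts i)) ≃ Fin n :=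
  finSigmaFinEquiv.trans (finCongr r.sum_eq)

/-- The index of the block which contains a given element of `[n]`. -/
def index (r : Comp p n) (k : Fin n) : Fin p := (r.blockEquiv.symm k).1

/-- The Young subgroup `Σ_{r₁} × ⋯ × Σ_{r_p}` of `Σ_n`: the permutations which preserve
each block. -/
def young (r : Comp p n) : Subgroup (Perm (Fin n)) where
  carrier := {σ | ∀ k, r.index (σ k) = r.index k}
  one_mem' _ := rfl
  mul_mem' {σ τ} hσ hτ k := (hσ (τ k)).trans (hτ k)
  inv_mem' {σ} hσ k := by
    have h := hσ (σ.symm k)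
    rw [Equiv.apply_symm_apply] at h
    exact h.symm

theorem mem_young {r : Comp p n} {σ : Perm (Fin n)} :
    σ ∈ r.young ↔ ∀ k, r.index (σ k) = r.index k := Iff.rfl

/-- The permuted composition `r^ρ = (r_{ρ⁻¹(1)}, …, r_{ρ⁻¹(p)})`. -/
def permute (r : Comp p n) (ρ : Perm (Fin p)) : Comp p n where
  parts i := r.parts (ρ.symm i)
  sum_eq := (Equiv.sum_comp ρ.symm r.parts).trans r.sum_eq

/-- The block permutation `ρ^*`: it sends the `i`-th block of `r` onto the `ρ(i)`-th block
of `r^ρ`, preserving the order inside each block. -/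
def blockPerm (r : Comp p n) (ρ : Perm (Fin p)) : Perm (Fin n) :=
  r.blockEquiv.symm.trans
    ((Equiv.sigmaCongr ρ fun i => finCongr (by simp [permute])).trans
      (r.permute ρ).blockEquiv)

/-- The composition `(0, r₁, …, r_p)`. -/
def zeroCons (r : Comp p n) : Comp (p + 1) n where
  parts := Fin.cons 0 r.parts
  sum_eq := by simp [Fin.sum_univ_succ, r.sum_eq]

/-- The composition `r ∘₁ (l, m) = (l, m, r₂, …, r_p)`, where `l + m = r₁`. -/
def splitFirst (r : Comp (p + 1) n) (l m : ℕ) (h : l + m = r.parts 0) : Comp (p + 2) n where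
  parts := Fin.cons l (Fin.cons m (Fin.tail r.parts))
  sum_eq := by
    have := r.sum_eq
    simp only [Fin.sum_univ_succ, Fin.cons_zero, Fin.cons_succ, Fin.tail] at this ⊢
    omega

/-- The composition `q ▷ r` of `n` into `s` parts, whose `j`-th part is the sum of the `r_i` for
`i` in the `j`-th block of `q`. -/
def merge (q : Comp s p) (r : Comp p n) : Comp s n where
  parts j := ∑ i with q.index i = j, r.parts i
  sum_eq := (Finset.sum_fiberwise _ _ _).trans r.sum_eq

/-! Comparison of the blocks of different compositions. -/

theorem blockEquiv_val (r : Comp p n) (i : Fin p) (j : Fin (r.parts i)) :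
    (r.blockEquiv ⟨i, j⟩ : ℕ) = ∑ i' ∈ Finset.Iio i, r.parts i' + j := by
  simp only [blockEquiv, Equiv.trans_apply, finCongr_apply, Fin.val_cast, finSigmaFinEquiv_apply]
  congr 1
  refine Finset.sum_nbij (Fin.castLE i.2.le) ?_ ?_ ?_ ?_
  · intro a _
    simp [Fin.lt_def]
  · intro a _ b _ h
    simpa using h
  · intro a ha
    simp only [Finset.coe_Iio, Set.mem_Iio] at ha
    exact ⟨⟨a, ha⟩, by simp, by ext; simp⟩
  · intro a _
    rfl

theorem index_spec (r : Comp p n) (k : Fin n) :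
    ∑ i ∈ Finset.Iio (r.index k), r.parts i ≤ k ∧
      (k : ℕ) < ∑ i ∈ Finset.Iio (r.index k), r.parts i + r.parts (r.index k) := by
  have h := r.blockEquiv_val (r.blockEquiv.symm k).1 (r.blockEquiv.symm k).2
  have h2 := (r.blockEquiv.symm k).2.2
  simp only [Sigma.eta, Equiv.apply_symm_apply] at h
  simp only [index]
  omega

theorem sum_Iio_add_le (r : Comp p n) {a b : Fin p} (hab : a < b) :
    ∑ i ∈ Finset.Iio a, r.parts i + r.parts a ≤ ∑ i ∈ Finset.Iio b, r.parts i := by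
  rw [add_comm, ← Finset.sum_insert (by simp)]
  refine Finset.sum_le_sum_of_subset ?_
  intro c hc
  simp only [Finset.mem_insert, Finset.mem_Iio] at hc ⊢
  rcases hc with rfl | hc
  · exact hab
  · exact hc.trans hab

theorem index_eq (r : Comp p n) {k : Fin n} {i : Fin p}
    (h₁ : ∑ i' ∈ Finset.Iio i, r.parts i' ≤ k)
    (h₂ : (k : ℕ) < ∑ i' ∈ Finset.Iio i, r.parts i' + r.parts i) : r.index k = i := by
  obtain ⟨h₃, h₄⟩ := r.index_spec k
  rcases lt_trichotomy (r.index k) i with h | h | h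
  · have := r.sum_Iio_add_le h
    omega
  · exact h
  · have := r.sum_Iio_add_le h
    omega

theorem index_mono (r : Comp p n) : Monotone r.index := by
  intro k l hkl
  by_contra h
  have h : r.index l < r.index k := not_le.mp h
  have h₁ := (r.index_spec k).1
  have h₂ := (r.index_spec l).2
  have := r.sum_Iio_add_le h
  have : (k : ℕ) ≤ l := hkl
  omega

theorem index_of_monotone (r : Comp p n) (r' : Comp s n) (f : Fin p → Fin s) (hf : Monotone f)
    (h : ∀ j, r'.parts j = ∑ i with f i = j, r.parts i) (k : Fin n) :
    r'.index k = f (r.index k) := by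
  obtain ⟨h₁, h₂⟩ := r.index_spec k
  have hS : ∑ j ∈ Finset.Iio (f (r.index k)), r'.parts j =
      ∑ i with f i < f (r.index k), r.parts i := by
    simp only [h]
    rw [← Finset.sum_fiberwise_of_maps_to (s := Finset.univ.filter fun i => f i < f (r.index k))
      (t := Finset.Iio (f (r.index k))) (g := f) (by simp)]
    refine Finset.sum_congr rfl fun j hj => Finset.sum_congr ?_ fun _ _ => rfl
    ext i
    simp only [Finset.mem_Iio] at hj
    simp only [Finset.mem_filter, Finset.mem_univ, true_and]
    constructor
    · rintro rfl
      exact ⟨hj, rfl⟩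
    · exact fun h => h.2
  refine r'.index_eq ?_ ?_
  · rw [hS]
    refine le_trans (Finset.sum_le_sum_of_subset ?_) h₁
    intro i hi
    simp only [Finset.mem_filter, Finset.mem_univ, true_and, Finset.mem_Iio] at hi ⊢
    by_contra hc
    exact absurd (hf (not_lt.mp hc)) (not_le.mpr hi)
  · refine lt_of_lt_of_le h₂ ?_
    rw [hS, h, add_comm, ← Finset.sum_insert (by simp), ← Finset.sum_union]
    · refine Finset.sum_le_sum_of_subset ?_
      intro i hi
      simp only [Finset.mem_insert, Finset.mem_Iio, Finset.mem_union, Finset.mem_filter,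
        Finset.mem_univ, true_and] at hi ⊢
      rcases hi with rfl | hi
      · exact Or.inr rfl
      · exact (hf hi.le).lt_or_eq
    · rw [Finset.disjoint_filter]
      intro i _ h₃ h₄
      exact absurd h₄ h₃.ne

theorem index_merge (q : Comp s p) (r : Comp p n) (k : Fin n) :
    (merge q r).index k = q.index (r.index k) :=
  index_of_monotone _ _ _ q.index_mono (fun _ => rfl) k

theorem index_zeroCons (r : Comp p n) (k : Fin n) : r.zeroCons.index k = (r.index k).succ := by
  refine index_of_monotone r r.zeroCons Fin.succ (Fin.strictMono_succ).monotone ?_ k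
  intro j
  induction j using Fin.cases with
  | zero => simp [zeroCons]
  | succ j => simp [zeroCons, Finset.filter_eq']

theorem index_splitFirst (r : Comp (p + 1) n) (l m : ℕ) (h : l + m = r.parts 0) (k : Fin n) :
    r.index k = Fin.predAbove 0 ((r.splitFirst l m h).index k) := by
  refine index_of_monotone _ _ _ (Fin.predAbove_right_monotone 0) ?_ k
  intro j
  rw [Finset.sum_filter, Fin.sum_univ_succ, Fin.sum_univ_succ]
  induction j using Fin.cases with
  | zero => simp [splitFirst, h]
  | succ j => simp [splitFirst, Fin.tail, Fin.succ_ne_zero, eq_comm]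

theorem index_blockPerm (r : Comp p n) (ρ : Perm (Fin p)) (k : Fin n) :
    (r.permute ρ).index (r.blockPerm ρ k) = ρ (r.index k) := by
  simp only [index, blockPerm, Equiv.trans_apply, Equiv.symm_apply_apply]
  rfl

theorem young_le_merge (q : Comp s p) (r : Comp p n) : r.young ≤ (merge q r).young := by
  intro σ hσ k
  rw [index_merge, index_merge, mem_young.mp hσ]

theorem young_zeroCons (r : Comp p n) : r.zeroCons.young = r.young := by
  ext σ
  simp [mem_young, index_zeroCons]

theorem young_splitFirst_le (r : Comp (p + 1) n) (l m : ℕ) (h : l + m = r.parts 0) :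
    (r.splitFirst l m h).young ≤ r.young := by
  intro σ hσ k
  rw [index_splitFirst r l m h, index_splitFirst r l m h, mem_young.mp hσ]

theorem conj_mem_young (r : Comp p n) (ρ : Perm (Fin p)) {σ : Perm (Fin n)} :
    (r.blockPerm ρ)⁻¹ * σ * r.blockPerm ρ ∈ r.young ↔ σ ∈ (r.permute ρ).young := by
  have hk : ∀ k, r.index ((r.blockPerm ρ).symm k) = ρ.symm ((r.permute ρ).index k) := by
    intro k
    rw [Equiv.eq_symm_apply, ← index_blockPerm, Equiv.apply_symm_apply]
  constructor
  · intro h k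
    have := h ((r.blockPerm ρ).symm k)
    simpa [Perm.mul_apply, hk] using this
  · intro h k
    have := h (r.blockPerm ρ k)
    simp only [Perm.mul_apply, Perm.inv_def, hk, this, index_blockPerm, Equiv.symm_apply_apply]

end Comp

/-- A `Σ`-module: a sequence of representations `M n` of the symmetric groups `Σ_n`. -/
abbrev SigmaModule (F : Type u) [Field F] := ∀ n : ℕ, Rep.{v} F (Perm (Fin n))

section Invariants

variable {F : Type u} [Field F] (M : SigmaModule.{u, v} F) {n : ℕ}

/-- The subspace of the elements of `M n` which are invariant under a subgroup `H` of `Σ_n`. -/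
noncomputable abbrev Inv (H : Subgroup (Perm (Fin n))) : Submodule F (M n) :=
  Representation.invariants ((M n).ρ.comp H.subtype)

variable {M}

theorem mem_Inv {H : Subgroup (Perm (Fin n))} {x : M n} :
    x ∈ Inv M H ↔ ∀ σ ∈ H, (M n).ρ σ x = x := by
  simp [Representation.mem_invariants]

/-- An element invariant under `K` is invariant under any subgroup `H` of `K`. -/
def Inv.restrict {H K : Subgroup (Perm (Fin n))} (h : H ≤ K) (x : Inv M K) : Inv M H :=
  ⟨x, mem_Inv.mpr fun σ hσ => mem_Inv.mp x.2 σ (h hσ)⟩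

/-- If `x` is invariant under `Σ_r`, then `ρ^* · x` is invariant under `Σ_{r^ρ}`. -/
def Inv.permute {p : ℕ} (r : Comp p n) (ρ : Perm (Fin p)) (x : Inv M r.young) :
    Inv M (r.permute ρ).young :=
  ⟨(M n).ρ (r.blockPerm ρ) x, mem_Inv.mpr fun σ hσ => by
    have h := mem_Inv.mp x.2 _ ((r.conj_mem_young ρ).mpr hσ)
    conv_rhs => rw [← h]
    rw [← Module.End.mul_apply, ← Module.End.mul_apply, ← map_mul, ← map_mul]
    congr 2
    group⟩

theorem ρ_eq_of_coset {H K : Subgroup (Perm (Fin n))} (x : Inv M H) {a b : K}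
    (h : (a : K ⧸ H.subgroupOf K) = b) : (M n).ρ a (x : M n) = (M n).ρ b x := by
  have h := mem_Inv.mp x.2 _ (Subgroup.mem_subgroupOf.mp (QuotientGroup.eq.mp h))
  conv_lhs => rw [← h]
  rw [← Module.End.mul_apply, ← map_mul]
  congr 2
  simp

/-- The sum `∑_{σ ∈ K / H} σ · x` for `H ≤ K` and an `H`-invariant element `x`; it is a
`K`-invariant element. By `ρ_eq_of_coset` the terms do not depend on the representatives. -/
noncomputable def Inv.trace {H : Subgroup (Perm (Fin n))} (K : Subgroup (Perm (Fin n)))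
    (x : Inv M H) : Inv M K :=
  ⟨∑ᶠ s : K ⧸ H.subgroupOf K, (M n).ρ (s.out : K) x, mem_Inv.mpr fun σ hσ => by
    rw [← LinearMap.toAddMonoidHom_coe, AddMonoidHom.map_finsum _ (Set.toFinite _)]
    conv_rhs =>
      rw [← finsum_comp_equiv (MulAction.toPerm (⟨σ, hσ⟩ : K) : Perm (K ⧸ H.subgroupOf K))]
    refine finsum_congr fun s => ?_
    rw [LinearMap.toAddMonoidHom_coe, ← Module.End.mul_apply, ← map_mul]
    refine ρ_eq_of_coset x (a := ⟨σ, hσ⟩ * s.out) ?_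
    rw [QuotientGroup.out_eq', MulAction.toPerm_apply, ← smul_eq_mul,
      ← MulAction.Quotient.smul_coe, QuotientGroup.out_eq']⟩

end Invariants

/-- A basis of a `Σ`-module which is stable under the actions of the symmetric groups: for each
`n`, a subset of `M n` which is a basis of `M n` and which is mapped to itself by `Σ_n`. -/
structure StableBasis {F : Type u} [Field F] (M : SigmaModule.{u, v} F) where
  carrier : ∀ n, Set (M n)
  linearIndependent : ∀ n, LinearIndependent F (Subtype.val : carrier n → M n)
  span_eq_top : ∀ n, Submodule.span F (carrier n) = ⊤
  stable : ∀ n (σ : Perm (Fin n)), ∀ x ∈ carrier n, (M n).ρ σ x ∈ carrier n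

namespace StableBasis

variable {F : Type u} [Field F] {M : SigmaModule.{u, v} F} (B : StableBasis M) {n : ℕ}

/-- The action of `Σ_n` on the basis `B(n)`. -/
instance : MulAction (Perm (Fin n)) (B.carrier n) where
  smul σ x := ⟨(M n).ρ σ x, B.stable n σ x x.2⟩
  one_smul x := Subtype.ext (by change (M n).ρ 1 (x : M n) = x; simp)
  mul_smul σ τ x := Subtype.ext (by
    change (M n).ρ (σ * τ) (x : M n) = (M n).ρ σ ((M n).ρ τ x)
    simp)

theorem coe_smul (σ : Perm (Fin n)) (x : B.carrier n) :
    ((σ • x : B.carrier n) : M n) = (M n).ρ σ x := rfl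

/-- The set `H \ B(n)` of the orbits of `B(n)` under a subgroup `H` of `Σ_n`. -/
abbrev Orbits (H : Subgroup (Perm (Fin n))) := MulAction.orbitRel.Quotient H (B.carrier n)

/-- The class `[x]_H` of `x ∈ B(n)` under the action of the subgroup `H` of `Σ_n`. -/
abbrev cls (H : Subgroup (Perm (Fin n))) (x : B.carrier n) : B.Orbits H := Quotient.mk'' x

/-- The sum of the elements of an `H`-orbit of `B(n)`: it is an `H`-invariant element of `M n`. -/
noncomputable def orbitSum (H : Subgroup (Perm (Fin n))) (c : B.Orbits H) : Inv M H :=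
  ⟨∑ᶠ y : c.orbit, ((y : B.carrier n) : M n), mem_Inv.mpr fun σ hσ => by
    have : Finite c.orbit := by
      rw [MulAction.orbitRel.Quotient.orbit_eq_orbit_out c Quotient.out_eq']
      exact Set.finite_range _
    rw [← LinearMap.toAddMonoidHom_coe, AddMonoidHom.map_finsum _ (Set.toFinite _)]
    conv_rhs => rw [← finsum_comp_equiv (MulAction.toPerm (⟨σ, hσ⟩ : H) : Perm c.orbit)]
    rfl⟩

end StableBasis

/-- An object of the category `β(M)`: a vector space `A` with operations `β_{x,r} : A^p → A` for
all compositions `r` of `n` into `p` parts and all `Σ_r`-invariant `x ∈ M(n)`, which satisfy the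
relations (β1) to (β6). -/
structure Beta {F : Type u} [Field F] (M : SigmaModule.{u, v} F) where
  carrier : Type w
  [addCommGroup : AddCommGroup carrier]
  [module : Module F carrier]
  op : ∀ {p n : ℕ} (r : Comp p n), Inv M r.young → (Fin p → carrier) → carrier
  /-- (β1) -/
  op_permute : ∀ {p n : ℕ} (r : Comp p n) (x : Inv M r.young) (ρ : Perm (Fin p))
    (a : Fin p → carrier),
    op r x a = op (r.permute ρ) (Inv.permute r ρ x) (fun i => a (ρ⁻¹ i))
  /-- (β2); the compositions `r` and `(0, r)` have the same Young subgroup. -/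
  op_zeroCons : ∀ {p n : ℕ} (r : Comp p n) (x : Inv M r.zeroCons.young)
    (a₀ : carrier) (a : Fin p → carrier),
    op r.zeroCons x (Fin.cons a₀ a) = op r (Inv.restrict r.young_zeroCons.ge x) a
  /-- (β3) -/
  op_smul_cons : ∀ {p n : ℕ} (r : Comp (p + 1) n) (x : Inv M r.young) (c : F)
    (a₁ : carrier) (a : Fin p → carrier),
    op r x (Fin.cons (c • a₁) a) = c ^ r.parts 0 • op r x (Fin.cons a₁ a)
  /-- (β4) -/
  op_repeat : ∀ {s p n : ℕ} (r : Comp p n) (q : Comp s p) (x : Inv M r.young)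
    (a : Fin s → carrier),
    op r x (fun i => a (q.index i)) = op (q.merge r) (Inv.trace (q.merge r).young x) a
  /-- (β5) -/
  op_add_cons : ∀ {p n : ℕ} (r : Comp (p + 1) n) (x : Inv M r.young)
    (a₀ a₁ : carrier) (a : Fin p → carrier),
    op r x (Fin.cons (a₀ + a₁) a) =
      ∑ lm : Finset.HasAntidiagonal.antidiagonal (r.parts 0),
        op (r.splitFirst lm.1.1 lm.1.2 (Finset.HasAntidiagonal.mem_antidiagonal.mp lm.2))
          (Inv.restrict (r.young_splitFirst_le _ _ _) x) (Fin.cons a₀ (Fin.cons a₁ a))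
  /-- (β6) -/
  op_linear : ∀ {p n : ℕ} (r : Comp p n) (c : F) (x y : Inv M r.young) (a : Fin p → carrier),
    op r (c • x + y) a = c • op r x a + op r y a

/-- An object of the category `γ(M)`, for a `Σ`-module `M` with a stable basis `B`: a vector space
`A` with operations `γ_{[x],r} : A^p → A` for all compositions `r` of `n` into `p` parts and all
`Σ_r`-orbits `[x]` in `B(n)`, which satisfy the relations (γ1) to (γ5). -/
structure Gamma {F : Type u} [Field F] {M : SigmaModule.{u, v} F} (B : StableBasis M) where
  carrier : Type w
  [addCommGroup : AddCommGroup carrier]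
  [module : Module F carrier]
  op : ∀ {p n : ℕ} (r : Comp p n), B.Orbits r.young → (Fin p → carrier) → carrier
  /-- (γ1) -/
  op_permute : ∀ {p n : ℕ} (r : Comp p n) (x : B.carrier n) (ρ : Perm (Fin p))
    (a : Fin p → carrier),
    op r (B.cls r.young x) a =
      op (r.permute ρ) (B.cls (r.permute ρ).young (r.blockPerm ρ • x)) (fun i => a (ρ⁻¹ i))
  /-- (γ2) -/
  op_zeroCons : ∀ {p n : ℕ} (r : Comp p n) (x : B.carrier n) (a₀ : carrier) (a : Fin p → carrier),
    op r.zeroCons (B.cls r.zeroCons.young x) (Fin.cons a₀ a) = op r (B.cls r.young x) a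
  /-- (γ3) -/
  op_smul_cons : ∀ {p n : ℕ} (r : Comp (p + 1) n) (x : B.carrier n) (c : F)
    (a₁ : carrier) (a : Fin p → carrier),
    op r (B.cls r.young x) (Fin.cons (c • a₁) a) =
      c ^ r.parts 0 • op r (B.cls r.young x) (Fin.cons a₁ a)
  /-- (γ4); the stabiliser of `x` in `Σ_r` is a subgroup of the one in `Σ_{q ▷ r}`, hence the
  quotient of their orders is an integer, which is then mapped to `F`. -/
  op_repeat : ∀ {s p n : ℕ} (r : Comp p n) (q : Comp s p) (x : B.carrier n) (a : Fin s → carrier),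
    op r (B.cls r.young x) (fun i => a (q.index i)) =
      ((Nat.card (MulAction.stabilizer (q.merge r).young x) /
        Nat.card (MulAction.stabilizer r.young x) : ℕ) : F) •
          op (q.merge r) (B.cls (q.merge r).young x) a
  /-- (γ5); the inner sum is over the orbits of `Σ_{r ∘₁ (l, m)}` in the `Σ_r`-orbit of `x`. -/
  op_add_cons : ∀ {p n : ℕ} (r : Comp (p + 1) n) (x : B.carrier n)
    (a₀ a₁ : carrier) (a : Fin p → carrier),
    op r (B.cls r.young x) (Fin.cons (a₀ + a₁) a) =
      ∑ lm : Finset.HasAntidiagonal.antidiagonal (r.parts 0),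
        ∑ᶠ c ∈ B.cls
            (r.splitFirst lm.1.1 lm.1.2 (Finset.HasAntidiagonal.mem_antidiagonal.mp lm.2)).young ''
              MulAction.orbit r.young x,
          op (r.splitFirst lm.1.1 lm.1.2 (Finset.HasAntidiagonal.mem_antidiagonal.mp lm.2)) c
            (Fin.cons a₀ (Fin.cons a₁ a))

attribute [instance] Beta.addCommGroup Beta.module Gamma.addCommGroup Gamma.module

namespace Beta

variable {F : Type u} [Field F] {M : SigmaModule.{u, v} F}

/-- A morphism of `β(M)`: a linear map compatible with all the operations. -/
@[ext]
structure Hom (X Y : Beta.{u, v, w} M) where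
  toLinearMap : X.carrier →ₗ[F] Y.carrier
  map_op : ∀ {p n : ℕ} (r : Comp p n) (x : Inv M r.young) (a : Fin p → X.carrier),
    toLinearMap (X.op r x a) = Y.op r x (fun i => toLinearMap (a i))

instance : Category (Beta.{u, v, w} M) where
  Hom X Y := Hom X Y
  id X := ⟨LinearMap.id, fun _ _ _ => rfl⟩
  comp f g := ⟨g.toLinearMap ∘ₗ f.toLinearMap, fun r x a => by
    simp [f.map_op, g.map_op]⟩

end Beta

namespace Gamma

variable {F : Type u} [Field F] {M : SigmaModule.{u, v} F} {B : StableBasis M}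

/-- A morphism of `γ(M)`: a linear map compatible with all the operations. -/
@[ext]
structure Hom (X Y : Gamma.{u, v, w} B) where
  toLinearMap : X.carrier →ₗ[F] Y.carrier
  map_op : ∀ {p n : ℕ} (r : Comp p n) (c : B.Orbits r.young) (a : Fin p → X.carrier),
    toLinearMap (X.op r c a) = Y.op r c (fun i => toLinearMap (a i))

instance : Category (Gamma.{u, v, w} B) where
  Hom X Y := Hom X Y
  id X := ⟨LinearMap.id, fun _ _ _ => rfl⟩
  comp f g := ⟨g.toLinearMap ∘ₗ f.toLinearMap, fun r x a => by
    simp [f.map_op, g.map_op]⟩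

end Gamma

/-! Sums over orbits, needed to see that the functor `P_M` is well defined. -/

section OrbitSums

variable {V : Type*} [AddCommGroup V] {G X : Type*} [Group G] [MulAction G X]

theorem sum_group_eq_sum_coset [Fintype G] (L : Subgroup G) [Fintype L] [Fintype (G ⧸ L)]
    (g : G → V) : ∑ k, g k = ∑ s : G ⧸ L, ∑ l : L, g (s.out * l) := by
  rw [← Fintype.sum_prod_type']
  symm
  refine Fintype.sum_bijective (fun sl : (G ⧸ L) × L => sl.1.out * (sl.2 : G)) ⟨?_, ?_⟩ _ _
    fun _ => rfl
  · rintro ⟨s, l⟩ ⟨s', l'⟩ h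
    have hm := congrArg (fun k : G => (k : G ⧸ L)) h
    have hs : s = s' := by simpa using hm
    subst hs
    have hl : (l : G) = l' := by simpa using h
    rw [Subtype.ext hl]
  · intro k
    refine ⟨⟨(k : G ⧸ L), ⟨(k : G ⧸ L).out⁻¹ * k, ?_⟩⟩, by simp⟩
    exact QuotientGroup.eq.mp (QuotientGroup.out_eq' _)

theorem sum_group_eq_card_smul [Fintype G] (x : X) [Fintype (MulAction.orbit G x)] (f : X → V) :
    ∑ g : G, f (g • x) =
      Nat.card (MulAction.stabilizer G x) • ∑ y : MulAction.orbit G x, f y := by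
  classical
  rw [sum_group_eq_sum_coset (MulAction.stabilizer G x), Finset.smul_sum]
  symm
  refine Fintype.sum_equiv (MulAction.orbitEquivQuotientStabilizer G x) _ _ fun y => ?_
  have h : ((MulAction.orbitEquivQuotientStabilizer G x y).out • x : X) = y := by
    rw [← MulAction.orbitEquivQuotientStabilizer_symm_apply, QuotientGroup.out_eq',
      Equiv.symm_apply_apply]
  have h' : ∀ l : MulAction.stabilizer G x,
      ((MulAction.orbitEquivQuotientStabilizer G x y).out * (l : G)) • x = (y : X) := by
    intro l
    rw [mul_smul, l.2, h]
  simp [h', Nat.card_eq_fintype_card]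

theorem sum_coset_orbit_free [Finite G] {H K : Subgroup G} (h : H ≤ K) (x : X)
    [Fintype (K ⧸ H.subgroupOf K)] [Fintype (MulAction.orbit H x)]
    [Fintype (MulAction.orbit K x)] :
    ∑ s : K ⧸ H.subgroupOf K, ∑ y : MulAction.orbit H x,
        Finsupp.single ((s.out : G) • (y : X)) (1 : ℤ) =
      (Nat.card (MulAction.stabilizer K x) / Nat.card (MulAction.stabilizer H x)) •
        ∑ z : MulAction.orbit K x, Finsupp.single (z : X) (1 : ℤ) := by
  classical
  have := Fintype.ofFinite G
  have hd : Nat.card (MulAction.stabilizer H x) ∣ Nat.card (MulAction.stabilizer K x) := by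
    let φ : MulAction.stabilizer H x →* MulAction.stabilizer K x :=
      { toFun := fun a => ⟨⟨a.1.1, h a.1.2⟩, a.2⟩
        map_one' := rfl
        map_mul' := fun _ _ => rfl }
    refine Subgroup.card_dvd_of_injective φ ?_
    intro a b hab
    have : (a.1.1 : G) = b.1.1 := congrArg (fun c : MulAction.stabilizer K x => (c.1.1 : G)) hab
    exact Subtype.ext (Subtype.ext this)
  have hpos : Nat.card (MulAction.stabilizer H x) ≠ 0 := Nat.card_pos.ne'
  have key : Nat.card (MulAction.stabilizer H x) •
      (∑ s : K ⧸ H.subgroupOf K, ∑ y : MulAction.orbit H x,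
        Finsupp.single ((s.out : G) • (y : X)) (1 : ℤ)) =
      Nat.card (MulAction.stabilizer K x) •
        ∑ z : MulAction.orbit K x, Finsupp.single (z : X) (1 : ℤ) := by
    rw [← sum_group_eq_card_smul x (fun z => Finsupp.single z (1 : ℤ)),
      sum_group_eq_sum_coset (H.subgroupOf K), Finset.smul_sum]
    refine Finset.sum_congr rfl fun s _ => ?_
    rw [← sum_group_eq_card_smul x (fun z => Finsupp.single ((s.out : G) • z) (1 : ℤ))]
    refine (Fintype.sum_equiv (Subgroup.subgroupOfEquivOfLe h).toEquiv _ _ fun l => ?_).symm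
    rw [mul_smul]
    rfl
  rw [← smul_right_inj hpos, key, smul_smul, Nat.mul_div_cancel' hd]

theorem sum_coset_orbit [Finite G] {H K : Subgroup G} (h : H ≤ K) (x : X)
    [Fintype (K ⧸ H.subgroupOf K)] [Fintype (MulAction.orbit H x)]
    [Fintype (MulAction.orbit K x)] (f : X → V) :
    ∑ s : K ⧸ H.subgroupOf K, ∑ y : MulAction.orbit H x, f ((s.out : G) • (y : X)) =
      (Nat.card (MulAction.stabilizer K x) / Nat.card (MulAction.stabilizer H x)) •
        ∑ z : MulAction.orbit K x, f z := by
  have := congrArg (Finsupp.liftAddHom fun z : X => (zmultiplesHom V (f z) : ℤ →+ V))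
    (sum_coset_orbit_free h x)
  simpa [map_sum, map_nsmul] using this

end OrbitSums

namespace StableBasis

variable {F : Type u} [Field F] {M : SigmaModule.{u, v} F} (B : StableBasis M) {n : ℕ}

instance (H : Subgroup (Perm (Fin n))) (x : B.carrier n) : Finite (MulAction.orbit H x) :=
  Set.finite_range _

theorem coe_orbitSum (H : Subgroup (Perm (Fin n))) (x : B.carrier n)
    [Fintype (MulAction.orbit H x)] :
    (B.orbitSum H (B.cls H x) : M n) = ∑ y : MulAction.orbit H x, ((y : B.carrier n) : M n) :=
  finsum_eq_sum_of_fintype fun y : MulAction.orbit H x => ((y : B.carrier n) : M n)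

theorem permute_orbitSum {p : ℕ} (r : Comp p n) (ρ : Perm (Fin p)) (x : B.carrier n) :
    Inv.permute r ρ (B.orbitSum r.young (B.cls r.young x)) =
      B.orbitSum (r.permute ρ).young (B.cls (r.permute ρ).young (r.blockPerm ρ • x)) := by
  classical
  have := Fintype.ofFinite (MulAction.orbit r.young x)
  have := Fintype.ofFinite (MulAction.orbit (r.permute ρ).young (r.blockPerm ρ • x))
  apply Subtype.ext
  change (M n).ρ (r.blockPerm ρ) _ = _
  rw [coe_orbitSum, coe_orbitSum, map_sum]
  have hmem : ∀ y ∈ MulAction.orbit r.young x,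
      r.blockPerm ρ • y ∈ MulAction.orbit (r.permute ρ).young (r.blockPerm ρ • x) := by
    rintro _ ⟨σ, rfl⟩
    refine ⟨⟨r.blockPerm ρ * σ * (r.blockPerm ρ)⁻¹, ?_⟩, ?_⟩
    · rw [← r.conj_mem_young]
      convert σ.2 using 1
      group
    · simp [Subgroup.smul_def, mul_smul]
  refine Fintype.sum_bijective (fun y : MulAction.orbit r.young x =>
    (⟨r.blockPerm ρ • y.1, hmem y.1 y.2⟩ :
      MulAction.orbit (r.permute ρ).young (r.blockPerm ρ • x))) ⟨?_, ?_⟩ _ _ fun y => rfl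
  · intro y z hyz
    exact Subtype.ext (MulAction.injective (r.blockPerm ρ) (congrArg Subtype.val hyz))
  · rintro ⟨_, ⟨σ, rfl⟩⟩
    refine ⟨⟨(r.blockPerm ρ)⁻¹ • σ • r.blockPerm ρ • x,
      ⟨⟨_, (r.conj_mem_young ρ).mpr σ.2⟩, ?_⟩⟩, ?_⟩
    · simp [Subgroup.smul_def, mul_smul]
    · simp

theorem restrict_orbitSum_of_eq {H K : Subgroup (Perm (Fin n))} (h : H = K) (x : B.carrier n) :
    Inv.restrict h.le (B.orbitSum K (B.cls K x)) = B.orbitSum H (B.cls H x) := by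
  subst h
  rfl

theorem trace_orbitSum {H K : Subgroup (Perm (Fin n))} (h : H ≤ K) (x : B.carrier n) :
    Inv.trace K (B.orbitSum H (B.cls H x)) =
      ((Nat.card (MulAction.stabilizer K x) / Nat.card (MulAction.stabilizer H x) : ℕ) : F) •
        B.orbitSum K (B.cls K x) := by
  classical
  have := Fintype.ofFinite (K ⧸ H.subgroupOf K)
  have := Fintype.ofFinite (MulAction.orbit H x)
  have := Fintype.ofFinite (MulAction.orbit K x)
  apply Subtype.ext
  rw [Submodule.coe_smul, coe_orbitSum, Nat.cast_smul_eq_nsmul,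
    ← sum_coset_orbit h x (fun z => (z : M n))]
  simp only [Inv.trace, finsum_eq_sum_of_fintype, coe_orbitSum, map_sum]
  rfl

theorem restrict_orbitSum {H K : Subgroup (Perm (Fin n))} (h : H ≤ K) (x : B.carrier n) :
    Inv.restrict h (B.orbitSum K (B.cls K x)) =
      ∑ᶠ c ∈ B.cls H '' MulAction.orbit K x, B.orbitSum H c := by
  have hfin : (B.cls H '' MulAction.orbit K x).Finite := (Set.toFinite _).image _
  have hU : MulAction.orbit K x = ⋃ c ∈ B.cls H '' MulAction.orbit K x, c.orbit := by
    ext y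
    simp only [Set.mem_iUnion, exists_prop, Set.exists_mem_image,
      MulAction.orbitRel.Quotient.orbit_mk]
    constructor
    · exact fun hy => ⟨y, hy, MulAction.mem_orbit_self y⟩
    · rintro ⟨_, ⟨k, rfl⟩, ⟨g, rfl⟩⟩
      exact ⟨⟨g, h g.2⟩ * k, mul_smul _ _ _⟩
  apply Subtype.ext
  refine Eq.trans ?_ ((Inv M H).subtype.toAddMonoidHom.map_finsum_mem (B.orbitSum H) hfin).symm
  change ∑ᶠ y : MulAction.orbit K x, ((y : B.carrier n) : M n) =
    ∑ᶠ c ∈ B.cls H '' MulAction.orbit K x, ∑ᶠ y : c.orbit, ((y : B.carrier n) : M n)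
  simp only [finsum_set_coe_eq_finsum_mem]
  conv_lhs => rw [hU]
  refine finsum_mem_biUnion ?_ hfin ?_
  · intro c _ d _ hcd
    refine Set.disjoint_left.mpr fun y hc hd => hcd ?_
    rw [MulAction.orbitRel.Quotient.mem_orbit] at hc hd
    exact hc.symm.trans hd
  · rintro _ ⟨y, _, rfl⟩
    exact Set.finite_range _

end StableBasis

namespace Beta

variable {F : Type u} [Field F] {M : SigmaModule.{u, v} F}

/-- The operations of an object of `β(M)`, as linear maps in the parameter `x ∈ M(n)^{Σ_r}`. -/
def opLin (X : Beta.{u, v, w} M) {p n : ℕ} (r : Comp p n) (a : Fin p → X.carrier) :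
    Inv M r.young →ₗ[F] X.carrier :=
  have h0 : X.op r 0 a = 0 := by simpa using X.op_linear r 1 0 0 a
  { toFun := fun x => X.op r x a
    map_add' := fun x y => by simpa using X.op_linear r 1 x y a
    map_smul' := fun c x => by simpa [h0] using X.op_linear r c x 0 a }

theorem opLin_apply (X : Beta.{u, v, w} M) {p n : ℕ} (r : Comp p n) (a : Fin p → X.carrier)
    (x : Inv M r.young) : X.opLin r a x = X.op r x a := rfl

end Beta

/-- The object `P_M(A, β) = (A, γ)` of `γ(M)`, where `γ_{[x],r} = β_{O([x]),r}` and `O([x])` is the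
sum of the elements of the `Σ_r`-orbit `[x]`. -/
noncomputable def Beta.toGamma {F : Type u} [Field F] {M : SigmaModule.{u, v} F}
    (B : StableBasis M) (X : Beta.{u, v, w} M) : Gamma.{u, v, w} B where
  carrier := X.carrier
  op r c a := X.op r (B.orbitSum r.young c) a
  op_permute r x ρ a := by
    rw [X.op_permute r _ ρ, B.permute_orbitSum]
  op_zeroCons r x a₀ a := by
    rw [X.op_zeroCons, B.restrict_orbitSum_of_eq r.young_zeroCons.symm]
  op_smul_cons r x c a₁ a := X.op_smul_cons r _ c a₁ a
  op_repeat r q x a := by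
    rw [X.op_repeat, B.trace_orbitSum (Comp.young_le_merge q r), ← X.opLin_apply, map_smul]
    rfl
  op_add_cons {p n} r x a₀ a₁ a := by
    rw [X.op_add_cons]
    refine Finset.sum_congr rfl fun lm _ => ?_
    rw [B.restrict_orbitSum, ← X.opLin_apply, ← LinearMap.toAddMonoidHom_coe,
      AddMonoidHom.map_finsum_mem _ _ ((Set.toFinite (MulAction.orbit r.young x)).image _)]
    rfl

/-- The functor `P_M : β(M) ⥤ γ(M)`; it does not change the underlying linear maps. -/
noncomputable def functorP {F : Type u} [Field F] {M : SigmaModule.{u, v} F}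
    (B : StableBasis M) : Beta.{u, v, w} M ⥤ Gamma.{u, v, w} B where
  obj X := X.toGamma B
  map f := ⟨f.toLinearMap, fun r _ a => f.map_op r _ a⟩

end GenDivPow

/-! The point is that the orbit sums `orbitSum` of the `Σ_r`-orbits in `B(n)` form a basis of the
invariants `M(n)^{Σ_r}`. An element `σ` permutes coordinates in the stable basis, so the coordinates
of an invariant vector are constant on orbits. They also have finite support, so the vector is a
finite combination of orbit sums (`span_orbitSum`). Distinct orbits are disjoint, which makes orbit
sums independent (`linearIndependent_orbitSum`).

By (β6), `β_{x,r}` is linear in `x`, hence determined by its values on orbit sums, and these are the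
operations `γ_{[x],r}`. Conversely, a family `γ` extends linearly in a unique way (`Gamma.opLin`).
For fixed arguments in `A`, each of (β1) to (β5) equates two linear maps in `x`, so it need only be
tested on orbit sums (`inv_hom_ext`). There it reduces to the γ-relation of the same number by the
formulas `permute_orbitSum`, `restrict_orbitSum` and `trace_orbitSum`, which also show that `P_M` is
well defined.

Neither construction touches the vector space or the linear maps, so the two composites are equal to
the identity functors, not merely isomorphic to them. -/

namespace GenDivPow

open CategoryTheory Equiv

/-! ### Linearity of restriction, block permutation and trace on invariants -/

section InvLinear

variable {F : Type u} [Field F] {M : SigmaModule.{u, v} F} {n : ℕ}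

/-- The inclusion of invariants `Inv.restrict` as a linear map. -/
def Inv.restrictLin {H K : Subgroup (Perm (Fin n))} (h : H ≤ K) : Inv M K →ₗ[F] Inv M H where
  toFun := Inv.restrict h
  map_add' _ _ := rfl
  map_smul' _ _ := rfl

theorem Inv.restrictLin_apply {H K : Subgroup (Perm (Fin n))} (h : H ≤ K) (x : Inv M K) :
    Inv.restrictLin h x = Inv.restrict h x := rfl

/-- The action `Inv.permute` of block permutations on invariants as a linear map. -/
def Inv.permuteLin {p : ℕ} (r : Comp p n) (ρ : Perm (Fin p)) :
    Inv M r.young →ₗ[F] Inv M (r.permute ρ).young where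
  toFun := Inv.permute r ρ
  map_add' x y := Subtype.ext (map_add ((M n).ρ (r.blockPerm ρ)) (x : M n) y)
  map_smul' c x := Subtype.ext (map_smul ((M n).ρ (r.blockPerm ρ)) c (x : M n))

theorem Inv.permuteLin_apply {p : ℕ} (r : Comp p n) (ρ : Perm (Fin p)) (x : Inv M r.young) :
    Inv.permuteLin r ρ x = Inv.permute r ρ x := rfl

/-- The relative trace `Inv.trace` as a linear map. -/
noncomputable def Inv.traceLin (H K : Subgroup (Perm (Fin n))) : Inv M H →ₗ[F] Inv M K where
  toFun := Inv.trace K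
  map_add' x y := Subtype.ext (by
    -- There are finitely many cosets, so the `finsum` is an honest finite sum and is additive.
    have := Fintype.ofFinite (K ⧸ H.subgroupOf K)
    simp [Inv.trace, finsum_eq_sum_of_fintype, Finset.sum_add_distrib])
  map_smul' c x := Subtype.ext (by
    have := Fintype.ofFinite (K ⧸ H.subgroupOf K)
    simp [Inv.trace, finsum_eq_sum_of_fintype, Finset.smul_sum])

theorem Inv.traceLin_apply (H K : Subgroup (Perm (Fin n))) (x : Inv M H) :
    Inv.traceLin H K x = Inv.trace K x := rfl

end InvLinear

/-! ### The basis of orbit sums in the invariants -/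

namespace StableBasis

variable {F : Type u} [Field F] {M : SigmaModule.{u, v} F} (B : StableBasis M) {n : ℕ}

/-- The basis of `M n` with underlying set `B.carrier n`. -/
noncomputable def basis (n : ℕ) : Module.Basis (B.carrier n) F (M n) :=
  Module.Basis.mk (B.linearIndependent n) (by
    rw [Subtype.range_coe]
    exact (B.span_eq_top n).ge)

theorem basis_apply (x : B.carrier n) : B.basis n x = (x : M n) := by
  simp [basis]

theorem basis_repr_coe (x : B.carrier n) : (B.basis n).repr (x : M n) = Finsupp.single x 1 := by
  rw [← B.basis_apply, Module.Basis.repr_self]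

/-- The coordinates of `σ · x` are those of `x`, permuted by `σ`. -/
theorem basis_repr_smul (σ : Perm (Fin n)) (x : M n) (y : B.carrier n) :
    (B.basis n).repr ((M n).ρ σ x) (σ • y) = (B.basis n).repr x y := by
  have h : (B.basis n).coord (σ • y) ∘ₗ (M n).ρ σ = (B.basis n).coord y := by
    -- On a basis vector `z` both sides are the indicator of `z = y`, because `σ` acts injectively
    -- on `B(n)`.
    refine (B.basis n).ext fun z => ?_
    rw [LinearMap.comp_apply, B.basis_apply, ← B.coe_smul, Module.Basis.coord_apply,
      Module.Basis.coord_apply, B.basis_repr_coe, B.basis_repr_coe]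
    classical
    simp [Finsupp.single_apply]
  exact LinearMap.congr_fun h x

/-- If `y = σ • z` with `σ ∈ H`, then `basis_repr_smul` compares the coordinate of `σ · x` at `y`
with that of `x` at `z`, and `σ · x = x`. -/
theorem basis_repr_eq_of_cls_eq {H : Subgroup (Perm (Fin n))} (x : Inv M H) {y z : B.carrier n}
    (h : B.cls H y = B.cls H z) : (B.basis n).repr (x : M n) y = (B.basis n).repr (x : M n) z := by
  obtain ⟨σ, rfl⟩ := MulAction.orbitRel_apply.mp (Quotient.eq''.mp h)
  have := B.basis_repr_smul (σ : Perm (Fin n)) (x : M n) z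
  rwa [mem_Inv.mp x.2 _ σ.2] at this

-- Both independence and spanning are read off from these coordinates, which are indicator functions
-- of pairwise disjoint orbits.
open Classical in
theorem basis_repr_orbitSum (H : Subgroup (Perm (Fin n))) (c : B.Orbits H) (y : B.carrier n) :
    (B.basis n).repr (B.orbitSum H c : M n) y = if B.cls H y = c then 1 else 0 := by
  induction c using Quotient.inductionOn' with
  | h x =>
    have := Fintype.ofFinite (MulAction.orbit H x)
    change (B.basis n).repr (B.orbitSum H (B.cls H x) : M n) y = _
    rw [B.coe_orbitSum, map_sum, Finsupp.finsetSum_apply]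
    simp only [basis_repr_coe, Finsupp.single_apply]
    split_ifs with h
    · have hy : y ∈ MulAction.orbit H x := MulAction.orbitRel_apply.mp (Quotient.eq''.mp h)
      rw [Finset.sum_eq_single ⟨y, hy⟩ _ (by simp), if_pos rfl]
      exact fun z _ hz => if_neg fun h => hz (Subtype.ext h)
    · refine Finset.sum_eq_zero fun z _ => if_neg ?_
      rintro rfl
      exact h (Quotient.eq''.mpr (MulAction.orbitRel_apply.mpr z.2))

/-- The coordinate at a representative of an orbit vanishes on all other orbit sums, so it isolates
one coefficient of a relation. -/
theorem linearIndependent_orbitSum (H : Subgroup (Perm (Fin n))) :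
    LinearIndependent F (B.orbitSum H) := by
  classical
  rw [linearIndependent_iff']
  intro s g hg c hc
  induction c using Quotient.inductionOn' with
  | h x =>
    have h := congrArg (fun z : Inv M H => (B.basis n).repr (z : M n) x) hg
    simpa [Finsupp.finsetSum_apply, basis_repr_orbitSum, hc] using h

theorem span_orbitSum (H : Subgroup (Perm (Fin n))) :
    Submodule.span F (Set.range (B.orbitSum H)) = ⊤ := by
  classical
  refine eq_top_iff.mpr fun x _ => ?_
  -- Only the orbits meeting the support contribute, so the sum is finite; the coefficient is the
  -- common coordinate of `x` on the orbit, read at an arbitrary representative.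
  have hx : x = ∑ c ∈ ((B.basis n).repr (x : M n)).support.image (B.cls H),
      (B.basis n).repr (x : M n) (Quotient.out c) • B.orbitSum H c := by
    refine Subtype.ext ((B.basis n).ext_elem fun y => ?_)
    have hout : (B.basis n).repr (x : M n) (Quotient.out (B.cls H y)) =
        (B.basis n).repr (x : M n) y := B.basis_repr_eq_of_cls_eq x (Quotient.out_eq' _)
    simp only [Submodule.coe_sum, Submodule.coe_smul, map_sum, map_smul, Finsupp.finsetSum_apply,
      Finsupp.smul_apply, basis_repr_orbitSum, smul_eq_mul, mul_ite, mul_one, mul_zero,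
      Finset.sum_ite_eq]
    rw [hout]
    split_ifs with h
    · rfl
    -- A nonzero coordinate at `y` would put the orbit of `y` among the summands.
    · by_contra hy
      exact h (Finset.mem_image_of_mem _ (Finsupp.mem_support_iff.mpr hy))
  rw [hx]
  exact Submodule.sum_mem _ fun c _ => Submodule.smul_mem _ _ (Submodule.subset_span ⟨c, rfl⟩)

/-- The orbit sums form a basis of the space of invariants. -/
noncomputable def invBasis (H : Subgroup (Perm (Fin n))) :
    Module.Basis (B.Orbits H) F (Inv M H) :=
  Module.Basis.mk (B.linearIndependent_orbitSum H) (B.span_orbitSum H).ge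

theorem invBasis_apply (H : Subgroup (Perm (Fin n))) (c : B.Orbits H) :
    B.invBasis H c = B.orbitSum H c := by
  simp [invBasis]

/-- Linear maps on invariants which agree on the sums of the orbits of basis elements are equal. -/
theorem inv_hom_ext {H : Subgroup (Perm (Fin n))} {V : Type*} [AddCommGroup V] [Module F V]
    {f g : Inv M H →ₗ[F] V}
    (h : ∀ x : B.carrier n, f (B.orbitSum H (B.cls H x)) = g (B.orbitSum H (B.cls H x))) :
    f = g := by
  refine (B.invBasis H).ext fun c => ?_
  rw [invBasis_apply]
  induction c using Quotient.inductionOn' with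
  | h x => exact h x

end StableBasis

/-! ### Linear extension of the γ-operations -/

namespace Gamma

variable {F : Type u} [Field F] {M : SigmaModule.{u, v} F} {B : StableBasis M}

/-- The linear extension of the operations of an object of `γ(M)` to all invariants. -/
noncomputable def opLin (X : Gamma.{u, v, w} B) {p n : ℕ} (r : Comp p n) (a : Fin p → X.carrier) :
    Inv M r.young →ₗ[F] X.carrier :=
  (B.invBasis r.young).constr F fun c => X.op r c a

theorem opLin_orbitSum (X : Gamma.{u, v, w} B) {p n : ℕ} (r : Comp p n) (a : Fin p → X.carrier)
    (c : B.Orbits r.young) : X.opLin r a (B.orbitSum r.young c) = X.op r c a := by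
  rw [← B.invBasis_apply, opLin, Module.Basis.constr_basis]

/-- The object of `β(M)` whose operations extend those of an object of `γ(M)` linearly. -/
noncomputable def toBeta (X : Gamma.{u, v, w} B) : Beta.{u, v, w} M where
  carrier := X.carrier
  op r x a := X.opLin r a x
  op_permute r x ρ a := by
    -- The right-hand side is written as a linear map in the invariant, which reduces the relation
    -- to orbit sums; (β2) to (β5) are treated in the same way.
    refine LinearMap.congr_fun (g := X.opLin (r.permute ρ) (fun i => a (ρ⁻¹ i)) ∘ₗ
      Inv.permuteLin r ρ) (B.inv_hom_ext fun x => ?_) x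
    rw [LinearMap.comp_apply, Inv.permuteLin_apply, B.permute_orbitSum, opLin_orbitSum,
      opLin_orbitSum, X.op_permute r x ρ]
  op_zeroCons r x a₀ a := by
    refine LinearMap.congr_fun (g := X.opLin r a ∘ₗ Inv.restrictLin r.young_zeroCons.ge)
      (B.inv_hom_ext fun x => ?_) x
    rw [LinearMap.comp_apply, Inv.restrictLin_apply, B.restrict_orbitSum_of_eq r.young_zeroCons.symm, opLin_orbitSum, opLin_orbitSum,
      X.op_zeroCons]
  op_smul_cons r x c a₁ a := by
    refine LinearMap.congr_fun (g := c ^ r.parts 0 • X.opLin r (Fin.cons a₁ a))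
      (B.inv_hom_ext fun x => ?_) x
    rw [LinearMap.smul_apply, opLin_orbitSum, opLin_orbitSum, X.op_smul_cons]
  op_repeat r q x a := by
    refine LinearMap.congr_fun (f := X.opLin r fun i => a (q.index i))
      (g := X.opLin (q.merge r) a ∘ₗ Inv.traceLin r.young (q.merge r).young)
      (B.inv_hom_ext fun x => ?_) x
    -- The trace of an orbit sum produces exactly the stabiliser quotient of (γ4).
    rw [LinearMap.comp_apply, Inv.traceLin_apply, B.trace_orbitSum (Comp.young_le_merge q r),
      map_smul, opLin_orbitSum, opLin_orbitSum, X.op_repeat]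
  op_add_cons {p n} r x a₀ a₁ a := by
    refine (LinearMap.congr_fun (g := ∑ lm : Finset.HasAntidiagonal.antidiagonal (r.parts 0),
        X.opLin (r.splitFirst lm.1.1 lm.1.2 (Finset.HasAntidiagonal.mem_antidiagonal.mp lm.2))
          (Fin.cons a₀ (Fin.cons a₁ a)) ∘ₗ Inv.restrictLin (r.young_splitFirst_le _ _ _))
      (B.inv_hom_ext fun x => ?_) x).trans (LinearMap.sum_apply _ _ _)
    rw [LinearMap.sum_apply, opLin_orbitSum, X.op_add_cons]
    refine Finset.sum_congr rfl fun lm _ => ?_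
    -- Under the smaller Young subgroup the orbit breaks into suborbits, which index the inner sum
    -- of (γ5); there are finitely many, so the linear map passes through the `finsum`.
    rw [LinearMap.comp_apply, Inv.restrictLin_apply, B.restrict_orbitSum, ← LinearMap.toAddMonoidHom_coe,
      AddMonoidHom.map_finsum_mem _ _ ((Set.toFinite (MulAction.orbit r.young x)).image _)]
    simp only [LinearMap.toAddMonoidHom_coe, opLin_orbitSum]
  op_linear r c x y a := by rw [map_add, map_smul]

/-- Since `f` is itself linear, both sides are linear in `x`, and on orbit sums this is
compatibility with the γ-operations. -/
theorem Hom.map_opLin {X Y : Gamma.{u, v, w} B} (f : Hom X Y) {p n : ℕ} (r : Comp p n)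
    (x : Inv M r.young) (a : Fin p → X.carrier) :
    f.toLinearMap (X.opLin r a x) = Y.opLin r (fun i => f.toLinearMap (a i)) x := by
  refine LinearMap.congr_fun (f := f.toLinearMap ∘ₗ X.opLin r a) (B.inv_hom_ext fun x => ?_) x
  rw [LinearMap.comp_apply, opLin_orbitSum, opLin_orbitSum, f.map_op]

/-- The relations are propositions, so an object is determined by its data. Heterogeneous equality
is needed because the later data depend on the carrier. -/
theorem eq_of_op_heq {X Y : Gamma.{u, v, w} B} (hc : X.carrier = Y.carrier)
    (ha : X.addCommGroup ≍ Y.addCommGroup) (hm : X.module ≍ Y.module)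
    (ho : @Gamma.op _ _ _ _ X ≍ @Gamma.op _ _ _ _ Y) : X = Y := by
  cases X
  cases Y
  cases hc
  cases ha
  cases hm
  cases ho
  rfl

/-- Serves to compare morphisms whose endpoints are only propositionally equal. -/
theorem hom_heq {X Y X' Y' : Gamma.{u, v, w} B} (hX : X = X') (hY : Y = Y') {f : X ⟶ Y}
    {f' : X' ⟶ Y'} (h : Hom.toLinearMap f ≍ Hom.toLinearMap f') : f ≍ f' := by
  subst hX hY
  exact heq_of_eq (Hom.ext (eq_of_heq h))

theorem toGamma_toBeta (X : Gamma.{u, v, w} B) : X.toBeta.toGamma B = X := by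
  refine eq_of_op_heq rfl HEq.rfl HEq.rfl (heq_of_eq ?_)
  funext p n r c a
  exact X.opLin_orbitSum r a c

end Gamma

/-! ### The round trip starting from the β-operations -/

namespace Beta

variable {F : Type u} [Field F] {M : SigmaModule.{u, v} F}

theorem eq_of_op_heq {X Y : Beta.{u, v, w} M} (hc : X.carrier = Y.carrier)
    (ha : X.addCommGroup ≍ Y.addCommGroup) (hm : X.module ≍ Y.module)
    (ho : @Beta.op _ _ _ X ≍ @Beta.op _ _ _ Y) : X = Y := by
  cases X
  cases Y
  cases hc
  cases ha
  cases hm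
  cases ho
  rfl

theorem hom_heq {X Y X' Y' : Beta.{u, v, w} M} (hX : X = X') (hY : Y = Y') {f : X ⟶ Y}
    {f' : X' ⟶ Y'} (h : Hom.toLinearMap f ≍ Hom.toLinearMap f') : f ≍ f' := by
  subst hX hY
  exact heq_of_eq (Hom.ext (eq_of_heq h))

theorem toBeta_toGamma (B : StableBasis M) (X : Beta.{u, v, w} M) : (X.toGamma B).toBeta = X := by
  refine eq_of_op_heq rfl HEq.rfl HEq.rfl (heq_of_eq ?_)
  funext p n r x a
  -- By (β6) the original operation is linear in `x`, so it agrees with the extension of its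
  -- restriction to orbit sums.
  refine LinearMap.congr_fun (f := (X.toGamma B).opLin r a) (g := X.opLin r a)
    (B.inv_hom_ext fun x => ?_) x
  exact (X.toGamma B).opLin_orbitSum r a _

end Beta

/-- The inverse of the functor `P_M`, extending the operations linearly. -/
noncomputable def functorO {F : Type u} [Field F] {M : SigmaModule.{u, v} F}
    (B : StableBasis M) : Gamma.{u, v, w} B ⥤ Beta.{u, v, w} M where
  obj X := X.toBeta
  map f := ⟨f.toLinearMap, fun r x a => f.map_opLin r x a⟩

end GenDivPow

open CategoryTheory in
theorem mainTheorem5 {F : Type u} [Field F] (M : GenDivPow.SigmaModule.{u, v} F)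
    (B : GenDivPow.StableBasis M) :
    ∃ O : GenDivPow.Gamma.{u, v, w} B ⥤ GenDivPow.Beta.{u, v, w} M,
      GenDivPow.functorP.{u, v, w} B ⋙ O = 𝟭 (GenDivPow.Beta.{u, v, w} M) ∧
        O ⋙ GenDivPow.functorP.{u, v, w} B = 𝟭 (GenDivPow.Gamma.{u, v, w} B) := by
  refine ⟨GenDivPow.functorO B, Functor.hext (GenDivPow.Beta.toBeta_toGamma B) fun X Y f => ?_,
    Functor.hext GenDivPow.Gamma.toGamma_toBeta fun X Y f => ?_⟩
  -- Carriers and linear maps are definitionally unchanged by the round trip, so `HEq.rfl` suffices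
  -- for the morphisms.
  · exact GenDivPow.Beta.hom_heq (X.toBeta_toGamma B) (Y.toBeta_toGamma B) HEq.rfl
  · exact GenDivPow.Gamma.hom_heq X.toGamma_toBeta Y.toGamma_toBeta HEq.rfl
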